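/- **Setting.** Let HTop be the homotopy category of topological spaces and HPol its full subcategory of spaces having the homotopy type of a polyhedron. All inverse systems are indexed by nonempty directed preordered sets. *Expansions.* An HPol-expansion $\mathbf q\colon Y\to\mathbf Y=(Y_\mu,q_{\mu\mu'},M)$ of a space $Y$ consists of an inverse system $\mathbf Y$ in HPol and morphisms $q_\mu\colon Y\to Y_\mu$ of HTop with $q_{\mu\mu'}q_{\mu'}=q_\mu$ for $\mu\le\mu'$, such that (E1) every morphism $h\colon Y\to P$ of HTop with $P\in$ HPol equals $f q_\mu$ for some $\mu\in M$ and $f\colon Y_\mu\to P$; (E2) if $f_0,f_1\colon Y_\mu\to P$ with $P\in$ HPol satisfy $f_0q_\mu=f_1q_\mu$, then $f_0q_{\mu\mu'}=f_1q_{\mu\mu'}$ for some $\mu'\ge\mu$. *Coarse shape morphisms.* An $S^*$-morphism $(f,f^n_\mu)\colon(X_\lambda,p_{\lambda\lambda'},\Lambda)\to(Y_\mu,q_{\mu\mu'},M)$ consists of a function $f\colon M\to\Lambda$ and morphisms $f^n_\mu\colon X_{f(\mu)}\to Y_\mu$ ($n\in\mathbb N$, $\mu\in M$) such that for all $\mu\le\mu'$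 there are $\lambda\ge f(\mu),f(\mu')$ and $n$ with $q_{\mu\mu'}f^{n'}_{\mu'}p_{f(\mu')\lambda}=f^{n'}_\mu p_{f(\mu)\lambda}$ for all $n'\ge n$. Two of them, $(f,f^n_\mu)$ and $(g,g^n_\mu)$, are equivalent if for every $\mu$ there are $\lambda\ge f(\mu),g(\mu)$ and $n$ with $f^{n'}_\mu p_{f(\mu)\lambda}=g^{n'}_\mu p_{g(\mu)\lambda}$ for all $n'\ge n$. The equivalence classes are the morphisms of the category pro$^*$-HPol, with composition $(g,g^n_\nu)(f,f^n_\mu)=(fg,\,g^n_\nu f^n_{g(\nu)})$. For spaces $X,Y$, the set $Sh^*(X,Y)$ of coarse shape morphisms consists of the pro$^*$-HPol morphisms between HPol-expansions of $X$ and of $Y$, where two of them (possibly between different expansions) are identified if they correspond to each other under the canonical isomorphisms between the expansions. Composition is defined by representatives. A morphism $f$ of HTop induces the coarse shape morphism represented by the unique morphism $\mathbf f$ of pro-HPol with $\mathbf f\mathbf p=\mathbf q f$, where $\mathbf p,\mathbf q$ are HPol-expansions of the source and the target of $f$; it is again denoted by $f$, and $f_*(F^*)=f\circ F^*$. *Topology.*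 $Sh^*(X,Y)$ carries the topology with basis the sets $V_\mu^{F^*}=\{G^*\mid q_\mu\circ F^*=q_\mu\circ G^*\}$, $\mu\in M$, $F^*\in Sh^*(X,Y)$; it does not depend on the HPol-expansion $\mathbf q$ of $Y$. **Theorem.** Let $X$ and $Y$ be topological spaces. 1. For every HPol-expansion $\mathbf q\colon Y\to\mathbf Y=(Y_\mu,q_{\mu\mu'},M)$ of $Y$, the morphism $$\mathbf q_*=((q_\mu)_*)_{\mu\in M}\colon Sh^*(X,Y)\to\big(Sh^*(X,Y_\mu),(q_{\mu\mu'})_*,M\big)$$ is an inverse limit of this inverse system in the category Top of topological spaces, and each space $Sh^*(X,Y_\mu)$ is discrete. 2. The space $Sh^*(X,Y)$ is Tychonoff (completely regular and Hausdorff). -/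

import Mathlib

open CategoryTheory Opposite

universe u v w

namespace CoarseShape

/-! ### Inverse systems and the category pro*-T -/

section Pro

variable {T : Type u} [Category.{v} T]

/-- An inverse system in `T`, indexed by a (nonempty) directed preordered set: a contravariant
functor from the index set to `T`. -/
structure InvSys (T : Type u) [Category.{v} T] where
  Idx : Type w
  [preorder : Preorder Idx]
  [directed : IsDirectedOrder Idx]
  [nonempty : Nonempty Idx]
  diag : Idxᵒᵖ ⥤ T

attribute [instance] InvSys.preorder InvSys.directed InvSys.nonempty

/-- The term of index `a`. -/
abbrev InvSys.obj (X : InvSys.{u, v, w} T) (a : X.Idx) : T := X.diag.obj (op a)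

/-- The bonding morphism from the term of index `b` to the term of index `a`, for `a ≤ b`. -/
abbrev InvSys.bond (X : InvSys.{u, v, w} T) {a b : X.Idx} (h : a ≤ b) : X.obj b ⟶ X.obj a :=
  X.diag.map (homOfLE h).op

lemma InvSys.bond_bond (X : InvSys.{u, v, w} T) {a b c : X.Idx} (h : a ≤ b) (k : b ≤ c) :
    X.bond k ≫ X.bond h = X.bond (h.trans k) := by
  rw [← Functor.map_comp]; rfl

lemma InvSys.bond_bond_assoc (X : InvSys.{u, v, w} T) {a b c : X.Idx} (h : a ≤ b) (k : b ≤ c)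
    {t : T} (f : X.obj a ⟶ t) :
    X.bond k ≫ X.bond h ≫ f = X.bond (h.trans k) ≫ f := by
  rw [← Category.assoc, X.bond_bond]

lemma InvSys.bond_refl (X : InvSys.{u, v, w} T) (a : X.Idx) : X.bond (le_refl a) = 𝟙 _ :=
  X.diag.map_id _

/-- A morphism of inverse systems; its classes are the morphisms of pro-`T`. -/
structure SMor (X Y : InvSys.{u, v, w} T) where
  idx : Y.Idx → X.Idx
  map : ∀ b, X.obj (idx b) ⟶ Y.obj b
  comm : ∀ {b b' : Y.Idx} (h : b ≤ b'), ∃ (a : X.Idx) (k : idx b ≤ a) (k' : idx b' ≤ a),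
    X.bond k' ≫ map b' ≫ Y.bond h = X.bond k ≫ map b

/-- An `S*`-morphism of inverse systems. -/
structure SStarMor (X Y : InvSys.{u, v, w} T) where
  idx : Y.Idx → X.Idx
  map : ℕ → ∀ b, X.obj (idx b) ⟶ Y.obj b
  comm : ∀ {b b' : Y.Idx} (h : b ≤ b'), ∃ (a : X.Idx) (k : idx b ≤ a) (k' : idx b' ≤ a) (n : ℕ),
    ∀ n' ≥ n, X.bond k' ≫ map n' b' ≫ Y.bond h = X.bond k ≫ map n' b

/-- Equivalence of `S*`-morphisms. -/
def SStarMor.Rel {X Y : InvSys.{u, v, w} T} (f f' : SStarMor X Y) : Prop :=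
  ∀ b : Y.Idx, ∃ (a : X.Idx) (k : f.idx b ≤ a) (k' : f'.idx b ≤ a) (n : ℕ),
    ∀ n' ≥ n, X.bond k ≫ f.map n' b = X.bond k' ≫ f'.map n' b

lemma SStarMor.rel_equivalence (X Y : InvSys.{u, v, w} T) :
    Equivalence (SStarMor.Rel (X := X) (Y := Y)) where
  refl f b := ⟨f.idx b, le_rfl, le_rfl, 0, fun _ _ => rfl⟩
  symm h b := by
    obtain ⟨a, k, k', n, e⟩ := h b
    exact ⟨a, k', k, n, fun n' hn => (e n' hn).symm⟩
  trans h h' b := by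
    obtain ⟨a, k, k', n, e⟩ := h b
    obtain ⟨c, l, l', m, e'⟩ := h' b
    obtain ⟨d, hd, hd'⟩ := exists_ge_ge a c
    refine ⟨d, k.trans hd, l'.trans hd', max n m, fun n' hn => ?_⟩
    rw [← X.bond_bond_assoc k hd, e n' (le_trans (le_max_left _ _) hn), X.bond_bond_assoc,
      ← X.bond_bond_assoc l' hd', ← e' n' (le_trans (le_max_right _ _) hn), X.bond_bond_assoc]

instance SStarMor.setoid (X Y : InvSys.{u, v, w} T) : Setoid (SStarMor X Y) :=
  ⟨SStarMor.Rel, SStarMor.rel_equivalence X Y⟩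

/-- The identity `S*`-morphism. -/
def SStarMor.id (X : InvSys.{u, v, w} T) : SStarMor X X where
  idx a := a
  map _ a := 𝟙 _
  comm {a b} h := ⟨b, h, le_rfl, 0, fun _ _ => by
    rw [X.bond_refl, Category.id_comp, Category.id_comp, Category.comp_id]⟩

/-- Composition of `S*`-morphisms: first `f`, then `g`. -/
def SStarMor.comp {X Y Z : InvSys.{u, v, w} T} (f : SStarMor X Y) (g : SStarMor Y Z) :
    SStarMor X Z where
  idx c := f.idx (g.idx c)
  map n c := f.map n (g.idx c) ≫ g.map n c
  comm {c c'} h := by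
    obtain ⟨b, k, k', n, e⟩ := g.comm h
    obtain ⟨a₁, l₁, l₁', n₁, e₁⟩ := f.comm k
    obtain ⟨a₂, l₂, l₂', n₂, e₂⟩ := f.comm k'
    obtain ⟨a, ha₁, ha₂⟩ := exists_ge_ge a₁ a₂
    refine ⟨a, l₁.trans ha₁, l₂.trans ha₂, max n (max n₁ n₂), fun n' hn => ?_⟩
    have hn0 : n ≤ n' := le_trans (le_max_left _ _) hn
    have hn1 : n₁ ≤ n' := le_trans ((le_max_left _ _).trans (le_max_right _ _)) hn
    have hn2 : n₂ ≤ n' := le_trans ((le_max_right _ _).trans (le_max_right _ _)) hn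
    have e₁' := congrArg (fun t => X.bond ha₁ ≫ t ≫ g.map n' c) (e₁ n' hn1)
    have e₂' := congrArg (fun t => X.bond ha₂ ≫ t ≫ g.map n' c' ≫ Z.bond h) (e₂ n' hn2)
    simp only [Category.assoc, InvSys.bond_bond_assoc] at e₁' e₂' ⊢
    rw [← e₁', ← e₂', e n' hn0]

lemma SStarMor.comp_rel {X Y Z : InvSys.{u, v, w} T} {f f' : SStarMor X Y} {g g' : SStarMor Y Z}
    (hf : f.Rel f') (hg : g.Rel g') : (f.comp g).Rel (f'.comp g') := by
  intro c
  obtain ⟨b, k, k', n, e⟩ := hg c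
  obtain ⟨a, j, j', m, d⟩ := hf b
  obtain ⟨a₁, l₁, l₁', n₁, e₁⟩ := f.comm k
  obtain ⟨a₂, l₂, l₂', n₂, e₂⟩ := f'.comm k'
  obtain ⟨x, hx, hx₁⟩ := exists_ge_ge a a₁
  obtain ⟨y, hy, hy₂⟩ := exists_ge_ge x a₂
  refine ⟨y, (l₁.trans hx₁).trans hy, l₂.trans hy₂, max (max n m) (max n₁ n₂), fun n' hn => ?_⟩
  have hn0 : n ≤ n' := le_trans ((le_max_left _ _).trans (le_max_left _ _)) hn
  have hm0 : m ≤ n' := le_trans ((le_max_right _ _).trans (le_max_left _ _)) hn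
  have hn1 : n₁ ≤ n' := le_trans ((le_max_left _ _).trans (le_max_right _ _)) hn
  have hn2 : n₂ ≤ n' := le_trans ((le_max_right _ _).trans (le_max_right _ _)) hn
  have e₁' := congrArg (fun t => X.bond (hx₁.trans hy) ≫ t ≫ g.map n' c) (e₁ n' hn1)
  have e₂' := congrArg (fun t => X.bond hy₂ ≫ t ≫ g'.map n' c) (e₂ n' hn2)
  have d' := congrArg (fun t => X.bond (hx.trans hy) ≫ t ≫ Y.bond k' ≫ g'.map n' c) (d n' hm0)
  simp only [SStarMor.comp, Category.assoc, InvSys.bond_bond_assoc] at e₁' e₂' d' ⊢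
  rw [← e₁', ← e₂', e n' hn0, d']

/-- The category pro*-`T`: its objects are the inverse systems in `T`, its morphisms are the
equivalence classes of `S*`-morphisms. -/
instance proStar : Category (InvSys.{u, v, w} T) where
  Hom X Y := _root_.Quotient (SStarMor.setoid X Y)
  id X := ⟦SStarMor.id X⟧
  comp {_ _ _} f g := Quotient.map₂ SStarMor.comp (fun _ _ hf _ _ hg => SStarMor.comp_rel hf hg) f g
  id_comp {X Y} f := by
    refine Quotient.inductionOn f fun f => Quotient.sound fun b => ?_
    exact ⟨f.idx b, le_rfl, le_rfl, 0, fun n _ => by simp [SStarMor.comp, SStarMor.id]⟩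
  comp_id {X Y} f := by
    refine Quotient.inductionOn f fun f => Quotient.sound fun b => ?_
    exact ⟨f.idx b, le_rfl, le_rfl, 0, fun n _ => by simp [SStarMor.comp, SStarMor.id]⟩
  assoc {X Y Z W} f g h := by
    refine Quotient.inductionOn₃ f g h fun f g h => Quotient.sound fun b => ?_
    exact ⟨f.idx (g.idx (h.idx b)), le_rfl, le_rfl, 0, fun n _ => by simp [SStarMor.comp]⟩

/-- The `S*`-morphism that is constantly equal to a given morphism of inverse systems. -/
def SMor.const {X Y : InvSys.{u, v, w} T} (f : SMor X Y) : SStarMor X Y where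
  idx := f.idx
  map _ := f.map
  comm h := by
    obtain ⟨a, k, k', e⟩ := f.comm h
    exact ⟨a, k, k', 0, fun _ _ => e⟩

/-- The functor `J : pro-T ⥤ pro*-T` on (representatives of) morphisms. -/
def SMor.J {X Y : InvSys.{u, v, w} T} (f : SMor X Y) : X ⟶ Y :=
  Quotient.mk (SStarMor.setoid X Y) f.const

end Pro

/-! ### Expansions -/

section Expansion

variable {T : Type u} [Category.{v} T]

/-- A `P`-expansion of `X`, for the full subcategory of `T` on the objects with the property `P`:
a morphism `(proj a)` of pro-`T` from `X` to an inverse system `sys` of objects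
of `P` with the properties (E1) and (E2). -/
structure Expansion (P : ObjectProperty T) (X : T) where
  sys : InvSys.{u, v, w} T
  prop : ∀ a, P (sys.obj a)
  proj : ∀ a, X ⟶ sys.obj a
  proj_bond : ∀ {a b : sys.Idx} (h : a ≤ b), proj b ≫ sys.bond h = proj a
  e1 : ∀ (Q : T), P Q → ∀ h : X ⟶ Q, ∃ (a : sys.Idx) (f : sys.obj a ⟶ Q), proj a ≫ f = h
  e2 : ∀ (Q : T), P Q → ∀ (a : sys.Idx) (f₀ f₁ : sys.obj a ⟶ Q), proj a ≫ f₀ = proj a ≫ f₁ →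
    ∃ (b : sys.Idx) (h : a ≤ b), sys.bond h ≫ f₀ = sys.bond h ≫ f₁

variable {P : ObjectProperty T}

/-- The expansion `X → (X)` of an object of `P`, the rudimentary system `(X)` having the single
term `X`. -/
abbrev Expansion.rudimentary (X : T) (hX : P X) : Expansion.{u, v, w} P X where
  sys := { Idx := PUnit, diag := (Functor.const _).obj X }
  prop _ := hX
  proj _ := 𝟙 X
  proj_bond _ := Category.comp_id _
  e1 _ _ h := ⟨PUnit.unit, h, Category.id_comp _⟩
  e2 _ _ a f₀ f₁ h := ⟨a, le_rfl, by
    rw [Category.id_comp, Category.id_comp] at h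
    rw [h]⟩

/-- The morphism `φ` of inverse systems satisfies `φ ∘ p = q ∘ f` in pro-`T`. -/
def IsLift {X Y : T} (p : Expansion.{u, v, w} P X) (q : Expansion.{u, v, w} P Y) (f : X ⟶ Y)
    (φ : SMor p.sys q.sys) : Prop :=
  ∀ b, p.proj (φ.idx b) ≫ φ.map b = f ≫ q.proj b

lemma exists_isLift {X Y : T} (p : Expansion.{u, v, w} P X) (q : Expansion.{u, v, w} P Y)
    (f : X ⟶ Y) : ∃ φ, IsLift p q f φ := by
  choose i g hg using fun b => p.e1 _ (q.prop b) (f ≫ q.proj b)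
  refine ⟨⟨i, g, fun {b b'} h => ?_⟩, hg⟩
  obtain ⟨a, k, k'⟩ := exists_ge_ge (i b) (i b')
  obtain ⟨c, l, e⟩ := p.e2 _ (q.prop b) a (p.sys.bond k' ≫ g b' ≫ q.sys.bond h)
    (p.sys.bond k ≫ g b) (by
      simp only [← Category.assoc, p.proj_bond, hg]
      rw [Category.assoc, q.proj_bond])
  exact ⟨c, k.trans l, k'.trans l, by simpa only [InvSys.bond_bond_assoc] using e⟩

lemma IsLift.unique {X Y : T} {p : Expansion.{u, v, w} P X} {q : Expansion.{u, v, w} P Y}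
    {f : X ⟶ Y} {φ ψ : SMor p.sys q.sys} (hφ : IsLift p q f φ) (hψ : IsLift p q f ψ) :
    φ.J = ψ.J := by
  refine Quotient.sound fun b => ?_
  obtain ⟨a, k, k'⟩ := exists_ge_ge (φ.idx b) (ψ.idx b)
  obtain ⟨c, l, e⟩ := p.e2 _ (q.prop b) a (p.sys.bond k ≫ φ.map b) (p.sys.bond k' ≫ ψ.map b) (by
      simp only [← Category.assoc, p.proj_bond]
      rw [hφ, hψ])
  exact ⟨c, k.trans l, k'.trans l, 0, fun _ _ => by
    simp only [InvSys.bond_bond_assoc] at e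
    exact e⟩

/-- The image under `J` of the unique morphism `φ : 𝐗 → 𝐘` of pro-`P` with `φ ∘ p = q ∘ f`. -/
noncomputable def liftHom {X Y : T} (p : Expansion.{u, v, w} P X) (q : Expansion.{u, v, w} P Y)
    (f : X ⟶ Y) : p.sys ⟶ q.sys :=
  (exists_isLift p q f).choose.J

lemma IsLift.liftHom_eq {X Y : T} {p : Expansion.{u, v, w} P X} {q : Expansion.{u, v, w} P Y}
    {f : X ⟶ Y} {φ : SMor p.sys q.sys} (h : IsLift p q f φ) : liftHom p q f = φ.J :=
  IsLift.unique (exists_isLift p q f).choose_spec h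

lemma liftHom_id {X : T} (p : Expansion.{u, v, w} P X) : liftHom p p (𝟙 X) = 𝟙 p.sys := by
  let φ : SMor p.sys p.sys := ⟨fun a => a, fun _ => 𝟙 _, fun {a b} h => ⟨b, h, le_rfl, by
    rw [p.sys.bond_refl, Category.id_comp, Category.id_comp, Category.comp_id]⟩⟩
  have h : IsLift p p (𝟙 X) φ := fun b => by simp [φ]
  rw [h.liftHom_eq]
  rfl

lemma liftHom_comp {X Y Z : T} (p : Expansion.{u, v, w} P X) (q : Expansion.{u, v, w} P Y)
    (r : Expansion.{u, v, w} P Z) (f : X ⟶ Y) (g : Y ⟶ Z) :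
    liftHom p q f ≫ liftHom q r g = liftHom p r (f ≫ g) := by
  obtain ⟨φ, hφ⟩ := exists_isLift p q f
  obtain ⟨ψ, hψ⟩ := exists_isLift q r g
  obtain ⟨χ, hχ⟩ := exists_isLift p r (f ≫ g)
  rw [hφ.liftHom_eq, hψ.liftHom_eq, hχ.liftHom_eq]
  refine Quotient.sound fun c => ?_
  obtain ⟨a, k, k'⟩ := exists_ge_ge (φ.idx (ψ.idx c)) (χ.idx c)
  obtain ⟨d, l, e⟩ := p.e2 _ (r.prop c) a (p.sys.bond k ≫ φ.map (ψ.idx c) ≫ ψ.map c)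
    (p.sys.bond k' ≫ χ.map c) (by
      simp only [← Category.assoc, p.proj_bond]
      rw [hφ, hχ, Category.assoc, Category.assoc, hψ])
  exact ⟨d, k.trans l, k'.trans l, 0, fun _ _ => by
    simp only [InvSys.bond_bond_assoc] at e
    exact e⟩

end Expansion

/-! ### Coarse shape morphisms -/

section Sh

variable {T : Type u} [Category.{v} T] (P : ObjectProperty T)

/-- A representative of a coarse shape morphism: a morphism of pro*-`P` between expansions. -/
structure ShRep (X Y : T) where
  src : Expansion.{u, v, w} P X
  tgt : Expansion.{u, v, w} P Y
  hom : src.sys ⟶ tgt.sys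

/-- pro*-`P` equivalence: the square with `J(i)` and `J(j)` commutes, where `i` and `j` are the
canonical isomorphisms between the expansions of `X` and between those of `Y`. -/
instance ShRep.setoid (X Y : T) : Setoid (ShRep.{u, v, w} P X Y) where
  r F G := F.hom ≫ liftHom F.tgt G.tgt (𝟙 Y) = liftHom F.src G.src (𝟙 X) ≫ G.hom
  iseqv :=
    { refl := fun F => by simp [liftHom_id]
      symm := fun {F G} h => by
        have := congrArg (fun t => liftHom G.src F.src (𝟙 X) ≫ t ≫ liftHom G.tgt F.tgt (𝟙 Y)) h
        simp only [Category.assoc, liftHom_comp, Category.comp_id, liftHom_id] at this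
        rw [this, ← Category.assoc, liftHom_comp, Category.comp_id, liftHom_id, Category.id_comp]
      trans := fun {F G H} h h' => by
        have e : liftHom F.tgt H.tgt (𝟙 Y) = liftHom F.tgt G.tgt (𝟙 Y) ≫ liftHom G.tgt H.tgt (𝟙 Y) := by
          rw [liftHom_comp, Category.comp_id]
        rw [e, ← Category.assoc, h, Category.assoc, h', ← Category.assoc, liftHom_comp,
          Category.comp_id] }

/-- The set of coarse shape morphisms from `X` to `Y`, for the pair `(T, P)`. -/
def CoarseHom (X Y : T) : Type (max u v (w + 1)) := _root_.Quotient (ShRep.setoid.{u, v, w} P X Y)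

variable {P}

/-- Composition of coarse shape morphisms: `⟨f⟩` followed by `⟨g⟩` is `⟨g f⟩` when the target
expansion of `f` is the source expansion of `g`; in general the canonical isomorphism between these
expansions is inserted. -/
noncomputable def CoarseHom.comp {X Y Z : T} (F : CoarseHom.{u, v, w} P X Y)
    (G : CoarseHom.{u, v, w} P Y Z) : CoarseHom.{u, v, w} P X Z :=
  Quotient.map₂ (fun f g => ⟨f.src, g.tgt, f.hom ≫ liftHom f.tgt g.src (𝟙 Y) ≫ g.hom⟩)
    (fun f f' hf g g' hg => by
      change f.hom ≫ _ = _ ≫ f'.hom at hf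
      change g.hom ≫ _ = _ ≫ g'.hom at hg
      change (f.hom ≫ _ ≫ g.hom) ≫ liftHom g.tgt g'.tgt (𝟙 Z) =
        liftHom f.src f'.src (𝟙 X) ≫ f'.hom ≫ _ ≫ g'.hom
      rw [← Category.assoc (liftHom f.src f'.src (𝟙 X)), ← hf, Category.assoc, Category.assoc, hg,
        ← Category.assoc (liftHom f.tgt g.src _), liftHom_comp, Category.assoc,
        ← Category.assoc (liftHom f.tgt f'.tgt _), liftHom_comp]) F G

/-- The coarse shape morphism `S*(f)` induced by a morphism `f` of `T`, computed with expansions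
`p` and `q` of its source and target. -/
noncomputable def CoarseHom.ofHom {X Y : T} (p : Expansion.{u, v, w} P X)
    (q : Expansion.{u, v, w} P Y) (f : X ⟶ Y) : CoarseHom.{u, v, w} P X Y :=
  Quotient.mk (ShRep.setoid P X Y) ⟨p, q, liftHom p q f⟩

/-- `S*(f)` does not depend on the expansions. -/
lemma CoarseHom.ofHom_eq {X Y : T} (p p' : Expansion.{u, v, w} P X)
    (q q' : Expansion.{u, v, w} P Y) (f : X ⟶ Y) : ofHom p q f = ofHom p' q' f := by
  refine Quotient.sound ?_
  change liftHom p q f ≫ liftHom q q' (𝟙 Y) = liftHom p p' (𝟙 X) ≫ liftHom p' q' f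
  rw [liftHom_comp, liftHom_comp, Category.comp_id, Category.id_comp]

lemma CoarseHom.comp_ofHom_id {X Y : T} (q q' : Expansion.{u, v, w} P Y)
    (F : CoarseHom.{u, v, w} P X Y) : F.comp (ofHom q q' (𝟙 Y)) = F := by
  refine Quotient.inductionOn F fun f => Quotient.sound ?_
  change (f.hom ≫ liftHom f.tgt q (𝟙 Y) ≫ liftHom q q' (𝟙 Y)) ≫ liftHom q' f.tgt (𝟙 Y) =
    liftHom f.src f.src (𝟙 X) ≫ f.hom
  simp only [Category.assoc, liftHom_comp, Category.comp_id, liftHom_id, Category.id_comp]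

lemma CoarseHom.comp_ofHom_comp {X Y Y' Y'' : T} (q : Expansion.{u, v, w} P Y)
    (q' q₁' : Expansion.{u, v, w} P Y') (q'' : Expansion.{u, v, w} P Y'') (f : Y ⟶ Y')
    (g : Y' ⟶ Y'') (F : CoarseHom.{u, v, w} P X Y) :
    (F.comp (ofHom q q' f)).comp (ofHom q₁' q'' g) = F.comp (ofHom q q'' (f ≫ g)) := by
  refine Quotient.inductionOn F fun F => Quotient.sound ?_
  change ((F.hom ≫ liftHom F.tgt q (𝟙 Y) ≫ liftHom q q' f) ≫ liftHom q' q₁' (𝟙 Y') ≫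
    liftHom q₁' q'' g) ≫ liftHom q'' q'' (𝟙 Y'') =
      liftHom F.src F.src (𝟙 X) ≫ F.hom ≫ liftHom F.tgt q (𝟙 Y) ≫ liftHom q q'' (f ≫ g)
  simp only [Category.assoc, liftHom_comp, Category.comp_id, liftHom_id, Category.id_comp]

/-- The map `f_* : Sh*(X, Y) → Sh*(X, Y')`, `F ↦ S*(f) ∘ F`, for a morphism `f : Y ⟶ Y'` of `T`. -/
noncomputable def pushforward (X : T) {Y Y' : T} (q : Expansion.{u, v, w} P Y)
    (q' : Expansion.{u, v, w} P Y') (f : Y ⟶ Y') (F : CoarseHom.{u, v, w} P X Y) :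
    CoarseHom.{u, v, w} P X Y' :=
  F.comp (CoarseHom.ofHom q q' f)

/-- The term of index `b` of an expansion, with its rudimentary expansion. -/
abbrev Expansion.term {Y : T} (q : Expansion.{u, v, w} P Y) (b : q.sys.Idx) :
    Expansion.{u, v, w} P (q.sys.obj b) :=
  Expansion.rudimentary _ (q.prop b)

/-- The map `(q_b)_* : Sh*(X, Y) → Sh*(X, Y_b)`, `F ↦ q_b ∘ F`. -/
noncomputable def projPush (X : T) {Y : T} (q : Expansion.{u, v, w} P Y) (b : q.sys.Idx) :
    CoarseHom.{u, v, w} P X Y → CoarseHom.{u, v, w} P X (q.sys.obj b) :=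
  pushforward X q (q.term b) (q.proj b)

/-- The set `V_b^F = {G | q_b ∘ F = q_b ∘ G}`. -/
def basicNhd (X : T) {Y : T} (q : Expansion.{u, v, w} P Y) (b : q.sys.Idx)
    (F : CoarseHom.{u, v, w} P X Y) : Set (CoarseHom.{u, v, w} P X Y) :=
  {G | projPush X q b F = projPush X q b G}

/-- The topology on `Sh*(X, Y)` generated by the sets `V_b^F`, for all expansions of `Y`. The sets
`V_b^F` for any single expansion of `Y` form a basis of it, see `isTopologicalBasis_basicNhd`. -/
instance CoarseHom.topology (X Y : T) : TopologicalSpace (CoarseHom.{u, v, w} P X Y) :=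
  TopologicalSpace.generateFrom
    {V | ∃ (q : Expansion.{u, v, w} P Y) (b : q.sys.Idx) (F : CoarseHom.{u, v, w} P X Y),
      V = basicNhd X q b F}

lemma isOpen_basicNhd (X : T) {Y : T} (q : Expansion.{u, v, w} P Y) (b : q.sys.Idx)
    (F : CoarseHom.{u, v, w} P X Y) : IsOpen (basicNhd X q b F) :=
  TopologicalSpace.isOpen_generateFrom_of_mem ⟨q, b, F, rfl⟩

lemma exists_projPush_imp (X : T) {Y Q : T} (q q₁ : Expansion.{u, v, w} P Y)
    (r : Expansion.{u, v, w} P Q) (hQ : P Q) (f : Y ⟶ Q) :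
    ∃ b, ∀ F G : CoarseHom.{u, v, w} P X Y, projPush X q b F = projPush X q b G →
      pushforward X q₁ r f F = pushforward X q₁ r f G := by
  obtain ⟨b, g, rfl⟩ := q.e1 Q hQ f
  refine ⟨b, fun F G h => ?_⟩
  have := congrArg (pushforward X (q.term b) r g) h
  simp only [projPush, pushforward, CoarseHom.comp_ofHom_comp] at this
  simpa only [pushforward, CoarseHom.ofHom_eq q₁ q r r] using this

lemma projPush_mono (X : T) {Y : T} (q : Expansion.{u, v, w} P Y) {a b : q.sys.Idx} (h : a ≤ b)
    {F G : CoarseHom.{u, v, w} P X Y} (e : projPush X q b F = projPush X q b G) :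
    projPush X q a F = projPush X q a G := by
  have := congrArg (pushforward X (q.term b) (q.term a) (q.sys.bond h)) e
  simpa only [projPush, pushforward, CoarseHom.comp_ofHom_comp, q.proj_bond] using this

/-- For every expansion `q` of `Y`, the sets `V_b^F` form a basis of the topology. -/
lemma isTopologicalBasis_basicNhd (X : T) {Y : T} (q : Expansion.{u, v, w} P Y) :
    TopologicalSpace.IsTopologicalBasis
      {V | ∃ (b : q.sys.Idx) (F : CoarseHom.{u, v, w} P X Y), V = basicNhd X q b F} := by
  refine ⟨?_, ?_, ?_⟩
  · rintro _ ⟨a, F, rfl⟩ _ ⟨b, G, rfl⟩ H ⟨hF, hG⟩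
    obtain ⟨c, hac, hbc⟩ := exists_ge_ge a b
    refine ⟨_, ⟨c, H, rfl⟩, rfl, fun K hK => ⟨?_, ?_⟩⟩
    · exact Eq.trans hF (projPush_mono X q hac hK)
    · exact Eq.trans hG (projPush_mono X q hbc hK)
  · refine Set.eq_univ_of_forall fun F => ?_
    exact ⟨_, ⟨Classical.arbitrary _, F, rfl⟩, rfl⟩
  · refine le_antisymm ?_ ?_
    · refine le_generateFrom ?_
      rintro _ ⟨b, F, rfl⟩
      exact isOpen_basicNhd X q b F
    · refine le_generateFrom ?_
      rintro _ ⟨r, c, F, rfl⟩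
      obtain ⟨b, hb⟩ := exists_projPush_imp X q r (r.term c) (r.prop c) (r.proj c)
      rw [show basicNhd X r c F = ⋃₀ {V | ∃ G ∈ basicNhd X r c F, V = basicNhd X q b G} from ?_]
      · refine TopologicalSpace.GenerateOpen.sUnion _ ?_
        rintro _ ⟨G, -, rfl⟩
        exact TopologicalSpace.GenerateOpen.basic _ ⟨b, G, rfl⟩
      · refine Set.Subset.antisymm (fun G hG => ⟨_, ⟨G, hG, rfl⟩, rfl⟩) ?_
        rintro K ⟨_, ⟨G, hG, rfl⟩, hK⟩
        exact Eq.trans hG (hb G K hK)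

lemma continuous_pushforward (X : T) {Y Y' : T} (q : Expansion.{u, v, w} P Y)
    (q' : Expansion.{u, v, w} P Y') (f : Y ⟶ Y') : Continuous (pushforward X q q' f) := by
  refine (isTopologicalBasis_basicNhd X q').continuous_iff.2 ?_
  rintro _ ⟨c, F, rfl⟩
  obtain ⟨b, hb⟩ := exists_projPush_imp X q q (q'.term c) (q'.prop c) (f ≫ q'.proj c)
  refine isOpen_iff_forall_mem_open.2 fun G hG =>
    ⟨basicNhd X q b G, fun K hK => ?_, isOpen_basicNhd X q b G, rfl⟩
  refine Eq.trans hG ?_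
  simpa only [projPush, pushforward, CoarseHom.comp_ofHom_comp] using hb G K hK

/-- The inverse system `(Sh*(X, Y_b), (q_bb')_*)` of topological spaces induced by an expansion
`q : Y → (Y_b, q_bb')` of `Y`. -/
noncomputable def shSystem (X : T) {Y : T} (q : Expansion.{u, v, w} P Y) :
    q.sys.Idxᵒᵖ ⥤ TopCat.{max u v (w + 1)} where
  obj b := TopCat.of (CoarseHom.{u, v, w} P X (q.sys.diag.obj b))
  map {b c} h := TopCat.ofHom
    ⟨pushforward X (q.term b.unop) (q.term c.unop) (q.sys.diag.map h),
      continuous_pushforward X _ _ _⟩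
  map_id b := by
    ext F
    change CoarseHom.comp F (CoarseHom.ofHom _ _ (q.sys.diag.map (𝟙 b))) = F
    rw [q.sys.diag.map_id]
    exact CoarseHom.comp_ofHom_id _ _ F
  map_comp {b c d} h k := by
    ext F
    change CoarseHom.comp F (CoarseHom.ofHom _ _ (q.sys.diag.map (h ≫ k))) =
      (CoarseHom.comp F (CoarseHom.ofHom _ _ (q.sys.diag.map h))).comp
        (CoarseHom.ofHom _ _ (q.sys.diag.map k))
    rw [q.sys.diag.map_comp]
    exact (CoarseHom.comp_ofHom_comp _ _ _ _ _ _ F).symm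

/-- The morphism `q_* : Sh*(X, Y) → (Sh*(X, Y_b), (q_bb')_*)` with components `(q_b)_*`; a morphism
of pro-Top from a single space to an inverse system is a cone. -/
noncomputable def shCone (X : T) {Y : T} (q : Expansion.{u, v, w} P Y) :
    Limits.Cone (shSystem X q) where
  pt := TopCat.of (CoarseHom.{u, v, w} P X Y)
  π :=
    { app := fun b => TopCat.ofHom ⟨projPush X q b.unop, continuous_pushforward X _ _ _⟩
      naturality := fun {b c} h => by
        ext F
        change CoarseHom.comp F (CoarseHom.ofHom q (q.term c.unop) (q.proj c.unop)) =
          (CoarseHom.comp F (CoarseHom.ofHom q (q.term b.unop) (q.proj b.unop))).comp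
            (CoarseHom.ofHom _ _ (q.sys.diag.map h))
        rw [CoarseHom.comp_ofHom_comp, ← q.proj_bond (leOfHom h.unop)]
        rfl }

end Sh

/-! ### The homotopy category of polyhedra -/

section Homotopy

/-- The points of the geometric realization of a simplicial complex, in barycentric
coordinates. -/
def Realization {ι : Type u} (K : AbstractSimplicialComplex ι) : Type u :=
  {x : ι → ℝ // ∃ s ∈ K.faces, (∀ i, 0 ≤ x i) ∧ (∀ i, i ∉ s → x i = 0) ∧ ∑ i ∈ s, x i = 1}

/-- The closed simplex of the realization spanned by a finite set of vertices. -/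
def closedSimplex {ι : Type u} (K : AbstractSimplicialComplex ι) (s : Finset ι) :
    Set (Realization K) :=
  {x | ∀ i, i ∉ s → x.1 i = 0}

/-- Each closed simplex carries its Euclidean topology. -/
abbrev closedSimplex.topology {ι : Type u} (K : AbstractSimplicialComplex ι) (s : Finset ι) :
    TopologicalSpace (closedSimplex K s) :=
  TopologicalSpace.induced (fun (x : closedSimplex K s) (i : ι) => x.1.1 i) inferInstance

/-- The weak topology: a subset of the realization is open if and only if its trace on each closed
simplex of the complex is open. -/
instance Realization.topology {ι : Type u} (K : AbstractSimplicialComplex ι) :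
    TopologicalSpace (Realization K) :=
  ⨆ s : {s : Finset ι // s ∈ K.faces},
    TopologicalSpace.coinduced (fun x : closedSimplex K s.1 => x.1) (closedSimplex.topology K s.1)

/-- Homotopy of continuous maps, as a relation on the morphisms of `TopCat`. -/
def homotopyRel : HomRel TopCat.{u} := fun _ _ f g => f.hom.Homotopic g.hom

/-- Homotopy is a congruence, so that passing to the quotient category identifies two maps exactly
if they are homotopic. -/
instance : Congruence homotopyRel.{u} where
  equivalence := ContinuousMap.Homotopic.equivalence.comap _
  comp_left f _ _ h := ContinuousMap.Homotopic.comp h (ContinuousMap.Homotopic.refl f.hom)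
  comp_right g h := ContinuousMap.Homotopic.comp (ContinuousMap.Homotopic.refl g.hom) h

/-- The homotopy category of topological spaces. -/
abbrev HTop : Type (u + 1) := CategoryTheory.Quotient homotopyRel.{u}

/-- A topological space, as an object of the homotopy category. -/
abbrev HTop.of (X : Type u) [TopologicalSpace X] : HTop.{u} := ⟨TopCat.of X⟩

/-- The (full) homotopy subcategory of polyhedra: the spaces which have the homotopy type of
a polyhedron, that is, of the realization of a simplicial complex. -/
def HPol : ObjectProperty HTop.{u} := fun X =>
  ∃ (ι : Type u) (K : AbstractSimplicialComplex ι),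
    Nonempty (ContinuousMap.HomotopyEquiv X.as (Realization K))

/-- The space `Sh*(X, Y)` of coarse shape morphisms between topological spaces. -/
abbrev Sh (X Y : HTop.{u}) : Type (u + 1) := CoarseHom.{u + 1, u, u} HPol.{u} X Y

/-- An HPol-expansion of a space. -/
abbrev HPolExpansion (Y : HTop.{u}) : Type (u + 1) := Expansion.{u + 1, u, u} HPol.{u} Y

end Homotopy

end CoarseShape

open CoarseShape

/-! Once expansions of `X` and `Y` are fixed, a coarse shape morphism is the same thing as a single
morphism of pro* between their systems (`CoarseHom.mk_surjective`, `CoarseHom.mk_injective`). For a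
term `Y_b` the rudimentary system can serve as target, so the claim about underlying sets becomes
Hom(𝐗, 𝐘) = lim Hom(𝐗, (Y_b)). This holds because everything about an `S*`-morphism is checked
locally: equivalence is tested at one index `b` at a time, and compatibility at one pair `b ≤ b'` at
a time, with a stage `n` that may depend on the pair. Hence components determine a morphism
(`Expansion.hom_ext`), and arbitrarily chosen representatives of compatible components already form
an `S*`-morphism (`Expansion.exists_hom`); the index function need not be monotone, so no further
choices are required.

The topology adds little. An object of `P` is its own expansion with identity projection, so its
basic sets are singletons and the space is discrete. In general `V_b^F` is the preimage of the point
`q_b ∘ F` under `(q_b)_*`. Thus `Sh*(X, Y)` has the initial topology for the maps `(q_b)_*` into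
discrete spaces; this gives the limit in Top, and an embedding into a product of discrete spaces,
which is Tychonoff. -/

namespace CoarseShape

section Limit

variable {T : Type u} [Category.{v} T] {P : ObjectProperty T}

/-! ### Representatives between fixed expansions -/

/-- The coarse shape morphism represented by a morphism between given expansions. -/
def CoarseHom.mk {X Y : T} (p : Expansion.{u, v, w} P X) (q : Expansion.{u, v, w} P Y)
    (φ : p.sys ⟶ q.sys) : CoarseHom.{u, v, w} P X Y :=
  Quotient.mk (ShRep.setoid P X Y) ⟨p, q, φ⟩

/-- Representatives carry their expansions with them, so the existence of expansions never has to be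
proved separately: any given coarse shape morphism supplies one. -/
lemma CoarseHom.exists_src {X Y : T} (F : CoarseHom.{u, v, w} P X Y) :
    Nonempty (Expansion.{u, v, w} P X) :=
  Quotient.inductionOn F fun f => ⟨f.src⟩

lemma CoarseHom.exists_tgt {X Y : T} (F : CoarseHom.{u, v, w} P X Y) :
    Nonempty (Expansion.{u, v, w} P Y) :=
  Quotient.inductionOn F fun f => ⟨f.tgt⟩

/-- Every coarse shape morphism is represented between any two given expansions. -/
lemma CoarseHom.mk_surjective {X Y : T} (p : Expansion.{u, v, w} P X)
    (q : Expansion.{u, v, w} P Y) : Function.Surjective (CoarseHom.mk p q) := by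
  refine fun F => Quotient.inductionOn F fun f => ?_
  -- The given representative is transported along the canonical isomorphisms of both expansions.
  refine ⟨liftHom p f.src (𝟙 X) ≫ f.hom ≫ liftHom f.tgt q (𝟙 Y), Quotient.sound ?_⟩
  change (liftHom p f.src (𝟙 X) ≫ f.hom ≫ liftHom f.tgt q (𝟙 Y)) ≫ liftHom q f.tgt (𝟙 Y) =
    liftHom p f.src (𝟙 X) ≫ f.hom
  simp only [Category.assoc, liftHom_comp, Category.comp_id, liftHom_id]

/-- The representative between two given expansions is unique. -/
lemma CoarseHom.mk_injective {X Y : T} (p : Expansion.{u, v, w} P X)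
    (q : Expansion.{u, v, w} P Y) : Function.Injective (CoarseHom.mk p q) := by
  intro φ ψ h
  have e : φ ≫ liftHom q q (𝟙 Y) = liftHom p p (𝟙 X) ≫ ψ := Quotient.exact h
  simpa only [liftHom_id, Category.comp_id, Category.id_comp] using e

/-- Turns `f_*` into composition in pro*, where components can be compared directly. -/
lemma pushforward_mk {X Y Y' : T} (p : Expansion.{u, v, w} P X) (q : Expansion.{u, v, w} P Y)
    (q' : Expansion.{u, v, w} P Y') (f : Y ⟶ Y') (φ : p.sys ⟶ q.sys) :
    pushforward X q q' f (CoarseHom.mk p q φ) = CoarseHom.mk p q' (φ ≫ liftHom q q' f) := by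
  change CoarseHom.mk p q' (φ ≫ liftHom q q (𝟙 Y) ≫ liftHom q q' f) = _
  rw [liftHom_id, Category.id_comp]

/-! ### Morphisms into a system as compatible families of components -/

/-- The projection of an expansion onto a term, as a morphism of inverse systems. -/
def Expansion.termMor {Y : T} (q : Expansion.{u, v, w} P Y) (b : q.sys.Idx) :
    SMor q.sys (q.term b).sys where
  idx _ := b
  map _ := 𝟙 _
  comm _ := ⟨b, le_rfl, le_rfl, by
    change _ ≫ 𝟙 _ ≫ 𝟙 _ = _
    rw [Category.comp_id]⟩

lemma Expansion.liftHom_proj {Y : T} (q : Expansion.{u, v, w} P Y) (b : q.sys.Idx) :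
    liftHom q (q.term b) (q.proj b) = (q.termMor b).J :=
  IsLift.liftHom_eq fun _ => rfl

/-- A bonding morphism, as a morphism of rudimentary systems. -/
def Expansion.bondMor {Y : T} (q : Expansion.{u, v, w} P Y) {a b : q.sys.Idx} (h : a ≤ b) :
    SMor (q.term b).sys (q.term a).sys where
  idx _ := PUnit.unit
  map _ := q.sys.bond h
  comm _ := ⟨PUnit.unit, le_rfl, le_rfl, by
    change _ ≫ _ ≫ 𝟙 _ = _
    rw [Category.comp_id]⟩

lemma Expansion.liftHom_bond {Y : T} (q : Expansion.{u, v, w} P Y) {a b : q.sys.Idx}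
    (h : a ≤ b) : liftHom (q.term b) (q.term a) (q.sys.bond h) = (q.bondMor h).J :=
  IsLift.liftHom_eq fun _ => by
    change 𝟙 _ ≫ q.sys.bond h = q.sys.bond h ≫ 𝟙 _
    rw [Category.id_comp, Category.comp_id]

/-- A morphism of pro*-`T` is determined by its components. -/
lemma Expansion.hom_ext {Y : T} (q : Expansion.{u, v, w} P Y) {Z : InvSys.{u, v, w} T}
    {φ ψ : Z ⟶ q.sys} (h : ∀ b, φ ≫ (q.termMor b).J = ψ ≫ (q.termMor b).J) : φ = ψ := by
  induction φ using Quotient.inductionOn with | _ f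
  induction ψ using Quotient.inductionOn with | _ g
  refine Quotient.sound fun b => ?_
  -- The rudimentary system has one index, and equivalence there is the condition at `b` up to
  -- composition with `𝟙`.
  obtain ⟨a, k, k', n, e⟩ := Quotient.exact (h b) PUnit.unit
  exact ⟨a, k, k', n, fun n' hn =>
    (congrArg (Z.bond k ≫ ·) (Category.comp_id (f.map n' b))).symm.trans
      ((e n' hn).trans (congrArg (Z.bond k' ≫ ·) (Category.comp_id (g.map n' b))))⟩

/-- Compatible components assemble to a morphism of pro*-`T`. -/
lemma Expansion.exists_hom {Y : T} (q : Expansion.{u, v, w} P Y) {Z : InvSys.{u, v, w} T}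
    (φ : ∀ b, Z ⟶ (q.term b).sys)
    (h : ∀ {a b : q.sys.Idx} (k : a ≤ b), φ b ≫ (q.bondMor k).J = φ a) :
    ∃ ψ : Z ⟶ q.sys, ∀ b, ψ ≫ (q.termMor b).J = φ b := by
  choose f hf using fun b => Quotient.exists_rep (φ b)
  -- The representatives `f b` are chosen independently; their compatibility up to equivalence is
  -- precisely the `comm` condition of an `S*`-morphism.
  let g : SStarMor Z q.sys :=
    { idx := fun b => (f b).idx PUnit.unit
      map := fun n b => (f b).map n PUnit.unit
      comm := fun {a b} k => by
        have e := h k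
        rw [← hf, ← hf] at e
        obtain ⟨c, l, l', n, e⟩ := Quotient.exact e PUnit.unit
        -- The bounds are swapped: equivalence lists the composite from `b` first, `comm` lists the
        -- smaller index `a` first.
        exact ⟨c, l', l, n, e⟩ }
  refine ⟨Quotient.mk (SStarMor.setoid _ _) g, fun b => ?_⟩
  rw [← hf]
  exact Quotient.sound fun _ => ⟨(f b).idx PUnit.unit, le_rfl, le_rfl, 0, fun n _ =>
    congrArg (Z.bond le_rfl ≫ ·) (Category.comp_id ((f b).map n PUnit.unit))⟩

/-! ### The limit property on underlying sets -/

/-- A coarse shape morphism to `Y` is determined by its projections to the terms of an expansion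
of `Y`. -/
lemma projPush_ext (X : T) {Y : T} (q : Expansion.{u, v, w} P Y)
    {F G : CoarseHom.{u, v, w} P X Y} (h : ∀ b, projPush X q b F = projPush X q b G) :
    F = G := by
  obtain ⟨p⟩ := F.exists_src
  obtain ⟨φ, rfl⟩ := CoarseHom.mk_surjective p q F
  obtain ⟨ψ, rfl⟩ := CoarseHom.mk_surjective p q G
  refine congrArg _ (q.hom_ext fun b => ?_)
  have e := h b
  rw [projPush, pushforward_mk, pushforward_mk, q.liftHom_proj] at e
  exact CoarseHom.mk_injective p _ e

/-- A compatible family of coarse shape morphisms to the terms of an expansion of `Y` comes from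
a coarse shape morphism to `Y`. -/
lemma exists_projPush_eq (X : T) {Y : T} (q : Expansion.{u, v, w} P Y)
    (F : ∀ b, CoarseHom.{u, v, w} P X (q.sys.obj b))
    (h : ∀ {a b : q.sys.Idx} (k : a ≤ b),
      pushforward X (q.term b) (q.term a) (q.sys.bond k) (F b) = F a) :
    ∃ G, ∀ b, projPush X q b G = F b := by
  -- Nonemptiness of the index set gives a member of the family, and with it an expansion of `X`
  -- common to all components.
  obtain ⟨p⟩ := (F (Classical.arbitrary _)).exists_src
  choose φ hφ using fun b => CoarseHom.mk_surjective p (q.term b) (F b)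
  obtain ⟨ψ, hψ⟩ := q.exists_hom φ fun {a b} k => by
    have e := h k
    rw [← hφ, ← hφ, pushforward_mk, q.liftHom_bond] at e
    exact CoarseHom.mk_injective p _ e
  refine ⟨CoarseHom.mk p q ψ, fun b => ?_⟩
  rw [projPush, pushforward_mk, q.liftHom_proj, hψ, hφ]

/-! ### Topology: discrete terms, the limit in Top, the Tychonoff property -/

/-- The space of coarse shape morphisms to an object of `P` is discrete. -/
lemma discreteTopology_coarseHom (X : T) {Q : T} (hQ : P Q) :
    DiscreteTopology (CoarseHom.{u, v, w} P X Q) := by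
  refine discreteTopology_iff_isOpen_singleton.2 fun F => ?_
  convert isOpen_basicNhd X (Expansion.rudimentary Q hQ) PUnit.unit F using 1
  ext G
  -- The projection of the rudimentary expansion is the identity, so `V^F` contains only `F`.
  have hid : ∀ H : CoarseHom.{u, v, w} P X Q,
      projPush X (Expansion.rudimentary Q hQ) PUnit.unit H = H :=
    fun H => CoarseHom.comp_ofHom_id _ _ H
  change G = F ↔ projPush X _ _ F = projPush X _ _ G
  rw [hid, hid, eq_comm]

/-- `q_*` is an inverse limit in the category of topological spaces. -/
noncomputable def isLimitShCone (X : T) {Y : T} (q : Expansion.{u, v, w} P Y) :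
    Limits.IsLimit (shCone X q) := by
  have key : ∀ (s : Limits.Cone (shSystem X q)) (x : s.pt),
      ∃ G : CoarseHom.{u, v, w} P X Y, ∀ b : q.sys.Idx,
        projPush X q b G = (s.π.app (op b)).hom x := fun s x =>
    exists_projPush_eq X q (fun b => (s.π.app (op b)).hom x) fun {a b} k =>
      congrArg (fun t => t.hom x) (s.w (homOfLE k).op)
  choose G hG using key
  refine
    { lift := fun s => TopCat.ofHom ⟨G s, ?_⟩
      fac := fun s b => TopCat.hom_ext (ContinuousMap.ext fun x => hG s x b.unop)
      uniq := fun s m hm => TopCat.hom_ext (ContinuousMap.ext fun x => ?_) }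
  · refine (isTopologicalBasis_basicNhd X q).continuous_iff.2 ?_
    rintro _ ⟨b, F, rfl⟩
    have := discreteTopology_coarseHom.{u, v, w} X (q.prop b)
    -- Over `V_b^F` only the component `b` of the cone matters, and there the target is discrete.
    have e : G s ⁻¹' basicNhd X q b F = (s.π.app (op b)).hom ⁻¹' {projPush X q b F} := by
      exact Set.ext fun x =>
        ⟨fun h => (hG s x b).symm.trans (Eq.symm h), fun h => Eq.symm ((hG s x b).trans h)⟩
    exact e ▸ (isOpen_discrete {projPush X q b F}).preimage (s.π.app (op b)).hom.continuous
  · refine projPush_ext X q fun b => (Eq.trans ?_ (hG s x b).symm)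
    exact congrArg (fun t => t.hom x) (hm (op b))

/-- An expansion embeds the space of coarse shape morphisms into a product of discrete spaces. -/
lemma isEmbedding_projPush (X : T) {Y : T} (q : Expansion.{u, v, w} P Y) :
    Topology.IsEmbedding (fun (F : CoarseHom.{u, v, w} P X Y) b => projPush X q b F) := by
  refine ⟨⟨le_antisymm ?_ ?_⟩, fun F G h => projPush_ext X q (congrFun h)⟩
  · exact (continuous_pi fun b => continuous_pushforward X _ _ _).le_induced
  · rw [(isTopologicalBasis_basicNhd X q).eq_generateFrom]
    refine le_generateFrom ?_
    rintro _ ⟨b, F, rfl⟩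
    have := discreteTopology_coarseHom.{u, v, w} X (q.prop b)
    -- `V_b^F` is cut out by prescribing the coordinate `b` in the product.
    refine ⟨_, (isOpen_discrete {projPush X q b F}).preimage (continuous_apply b), ?_⟩
    ext G
    exact eq_comm

/-- The empty space is treated separately, since no expansion of `Y` need then be available for
general `P`. -/
instance (X Y : T) : T35Space (CoarseHom.{u, v, w} P X Y) := by
  rcases isEmpty_or_nonempty (CoarseHom.{u, v, w} P X Y) with _ | ⟨⟨F⟩⟩
  · infer_instance
  · obtain ⟨q⟩ := F.exists_tgt
    have := fun b => discreteTopology_coarseHom.{u, v, w} X (q.prop b)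
    exact (isEmbedding_projPush X q).t35Space

end Limit

end CoarseShape

open CoarseShape
theorem theorem3p4 (X Y : Type u) [TopologicalSpace X] [TopologicalSpace Y] :
    (∀ q : HPolExpansion (HTop.of Y),
      Nonempty (Limits.IsLimit (shCone (HTop.of X) q)) ∧
      ∀ b : q.sys.Idx, DiscreteTopology (Sh (HTop.of X) (q.sys.obj b))) ∧
    T35Space (Sh (HTop.of X) (HTop.of Y)) :=
  ⟨fun q => ⟨⟨isLimitShCone _ q⟩, fun b => discreteTopology_coarseHom _ (q.prop b)⟩,
    inferInstance⟩
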